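/- Let $N\ge 0$ be an integer, let $h:\mathbb{P}^N(\overline{\mathbb{Q}})\to\mathbb{R}_{\ge 0}$ be the absolute logarithmic Weil height, and for an endomorphism (self-morphism) $\phi$ of $\mathbb{P}^N$ over $\overline{\mathbb{Q}}$ let $d_\phi$ be its degree (the common degree of homogeneous forms without common zeros that define it; for $N=0$, where this is not unique, take the least possible value) and $C(\phi)=\sup_{P\in\mathbb{P}^N(\overline{\mathbb{Q}})}|h(\phi(P))-d_\phi h(P)|$. Let $S$ be a set of endomorphisms of $\mathbb{P}^N(\overline{\mathbb{Q}})$ which is height controlled, that is, $\inf_{\phi\in S}d_\phi\ge 2$ and $\sup_{\phi\in S}C(\phi)<\infty$, and suppose that all maps in $S$ are defined over a fixed number field $K\subset\overline{\mathbb{Q}}$. Let $\nu$ be a discrete probability measure on $S$ and let $\bar\nu=\prod_{i\ge1}\nu$ be the product measure on the space $\Phi_S=\prod_{i\ge1}S$ of sequences in $S$, with the product $\sigma$-algebra of the discrete $\sigma$-algebras. For $\gamma=(\theta_1,\theta_2,\dots)\in\Phi_S$ put $\gamma_0^+=\mathrm{id}$, $\gamma_n^+=\theta_1\circ\theta_2\circ\cdots\circ\theta_n$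 for $n\ge 1$, and $\mathrm{Orb}_\gamma^+(P)=\{\gamma_n^+(P):n\ge0\}$. Then for every $P\in\mathbb{P}^N(\overline{\mathbb{Q}})$ the set $\{\gamma\in\Phi_S:\mathrm{Orb}_\gamma^+(P)\text{ is finite}\}$ is measurable, and its $\bar\nu$-probability is either $0$ or $1$. -/

import Mathlib

open scoped LinearAlgebra.Projectivization

/-- The field of algebraic numbers. -/
abbrev QBar : Type := AlgebraicClosure ℚ

instance QBar.isAlgebraic : Algebra.IsAlgebraic ℚ QBar := by
  have h : @Algebra.IsAlgebraic ℚ QBar _ _ (AlgebraicClosure.instAlgebra ℚ) :=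
    AlgebraicClosure.isAlgebraic ℚ
  convert h
  exact Subsingleton.elim _ _

/-- The set of points of projective `N`-space over the algebraic numbers. -/
abbrev ProjPt (N : ℕ) : Type := ℙ QBar (Fin (N + 1) → QBar)

namespace ProjPt

variable {N : ℕ}

/-- The field of definition `ℚ(P)`, generated by all quotients of homogeneous coordinates of `P`
(a quotient with zero denominator is `0` in Lean and contributes nothing). It does not depend on
the representative. -/
noncomputable def fieldOfDef (P : ProjPt N) : IntermediateField ℚ QBar :=
  IntermediateField.adjoin ℚ (Set.range fun ij : Fin (N + 1) × Fin (N + 1) => P.rep ij.1 / P.rep ij.2)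

instance (P : ProjPt N) : FiniteDimensional ℚ P.fieldOfDef :=
  haveI : Finite (Set.range fun ij : Fin (N + 1) × Fin (N + 1) => P.rep ij.1 / P.rep ij.2) :=
    (Set.finite_range _).to_subtype
  IntermediateField.finiteDimensional_adjoin fun x _ => Algebra.IsIntegral.isIntegral x

instance (P : ProjPt N) : NumberField P.fieldOfDef := {}

/-- An index of a nonvanishing homogeneous coordinate of `P`. -/
noncomputable def pivot (P : ProjPt N) : Fin (N + 1) :=
  (Function.ne_iff.mp P.rep_nonzero).choose

theorem rep_pivot_ne_zero (P : ProjPt N) : P.rep P.pivot ≠ 0 :=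
  (Function.ne_iff.mp P.rep_nonzero).choose_spec

/-- Homogeneous coordinates of `P` in the number field `ℚ(P)`. -/
noncomputable def normCoords (P : ProjPt N) (i : Fin (N + 1)) : P.fieldOfDef :=
  ⟨P.rep i / P.rep P.pivot, IntermediateField.subset_adjoin ℚ _ ⟨(i, P.pivot), rfl⟩⟩

/-- The absolute logarithmic Weil height of `P`: the logarithmic height of homogeneous coordinates
of `P` relative to the number field `F = ℚ(P)`, that is
`∑ v, [F_v : ℚ_v] * log (max_i |x_i|_v)` over all places `v` of `F`, divided by `[F : ℚ]`. -/
noncomputable def height (P : ProjPt N) : ℝ :=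
  Height.logHeight P.normCoords / (Module.finrank ℚ P.fieldOfDef : ℝ)

end ProjPt

/-- The map `φ` is `x ↦ [F₀(x) : … : F_N(x)]`, where the `Fᵢ` are homogeneous polynomials of degree
`d` over the algebraic numbers without common zeros in projective space. -/
structure IsGivenBy {N : ℕ} (φ : ProjPt N → ProjPt N) (d : ℕ)
    (F : Fin (N + 1) → MvPolynomial (Fin (N + 1)) QBar) : Prop where
  homogeneous : ∀ i, (F i).IsHomogeneous d
  no_common_zero : ∀ x : Fin (N + 1) → QBar, x ≠ 0 → (fun i => MvPolynomial.eval x (F i)) ≠ 0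
  map_mk : ∀ (x : Fin (N + 1) → QBar) (hx : x ≠ 0),
    φ (Projectivization.mk QBar x hx) =
      Projectivization.mk QBar (fun i => MvPolynomial.eval x (F i)) (no_common_zero x hx)

/-- Endomorphisms (self-morphisms) of projective `N`-space over the algebraic numbers, identified
with the maps that they induce on points. -/
structure ProjEnd (N : ℕ) where
  toFun : ProjPt N → ProjPt N
  isMorphism : ∃ d F, IsGivenBy toFun d F

namespace ProjEnd

variable {N : ℕ}

/-- The degree of an endomorphism: the degree of the forms without common zeros which define it.
For `N ≥ 1` it is uniquely determined by the map; for `N = 0` the least possible value is taken. -/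
noncomputable def degree (φ : ProjEnd N) : ℕ :=
  sInf {d | ∃ F, IsGivenBy φ.toFun d F}

/-- `φ` is defined over `K`: it is given by forms with coefficients in `K`. -/
def DefinedOver (φ : ProjEnd N) (K : IntermediateField ℚ QBar) : Prop :=
  ∃ d F, IsGivenBy φ.toFun d F ∧ ∀ i m, (F i).coeff m ∈ K

open scoped ENNReal in
/-- `C(φ) = sup_P |h(φ(P)) - deg(φ) h(P)|`, as an extended nonnegative real number. -/
noncomputable def htConst (φ : ProjEnd N) : ℝ≥0∞ :=
  ⨆ P : ProjPt N, ENNReal.ofReal |(φ.toFun P).height - (φ.degree : ℝ) * P.height|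

end ProjEnd

/-- `S` is height controlled: the infimum of the degrees of its elements is at least `2`, and the
supremum of the constants `C(φ)` for `φ ∈ S` is finite. -/
structure HeightControlled {N : ℕ} (S : Set (ProjEnd N)) : Prop where
  two_le_degree : 2 ≤ ⨅ φ ∈ S, (φ.degree : ℕ∞)
  htConst_lt_top : ⨆ φ ∈ S, φ.htConst < ⊤

/-- Sets of endomorphisms carry the discrete `σ`-algebra. -/
instance ProjEnd.measurableSpaceSet {N : ℕ} (S : Set (ProjEnd N)) : MeasurableSpace S := ⊤

/-- The product measure on the space of sequences of elements of `S` (with the product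
`σ`-algebra), all factors being the discrete probability measure `ν`. -/
noncomputable def seqMeasure {N : ℕ} {S : Set (ProjEnd N)} (ν : PMF S) :
    MeasureTheory.Measure (ℕ → S) :=
  MeasureTheory.Measure.infinitePi fun _ => ν.toMeasure

/-- The right iterates `γ_n⁺ = θ₁ ∘ θ₂ ∘ ⋯ ∘ θ_n` of `γ = (θ₁, θ₂, …)`, with `γ₀⁺ = id`; here
`θ_{n+1}` is `γ n`. -/
def rightIter {N : ℕ} {S : Set (ProjEnd N)} (γ : ℕ → S) : ℕ → ProjPt N → ProjPt N
  | 0 => id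
  | n + 1 => rightIter γ n ∘ (γ n).1.toFun

/-- The right orbit of `P` under `γ`: the set of all `γ_n⁺(P)`, `n ≥ 0`. -/
def rightOrbit {N : ℕ} {S : Set (ProjEnd N)} (γ : ℕ → S) (P : ProjPt N) : Set (ProjPt N) :=
  Set.range fun n => rightIter γ n P

/-! Since θ₁ is applied last, the right orbit of `P` is `P` together with the image under θ₁ of the
right orbit for the shifted sequence. A map of positive degree has finite fibres, so finiteness of
the orbit is unchanged by the shift (`HeightControlled.finite_rightOrbit_shift`). The event is
therefore a tail event, and Kolmogorov's law applies. Finite fibres follow by rescaling from those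
of the affine map `x ↦ F(x)`: by the Nullstellensatz, the polynomial ring modulo the `F i - c i` is
finite-dimensional (`MvPolynomial.finite_setOf_eval_eq`). -/

open MeasureTheory ProbabilityTheory Filter

/-! ### Finite fibres of morphisms -/

namespace MvPolynomial

attribute [local instance] MvPolynomial.gradedAlgebra in
/-- A homogeneous element of degree `n` of the ideal generated by forms `F i` of degree `d ≤ n` is
a combination of the `F i` with homogeneous coefficients of degree `n - d`. -/
theorem IsHomogeneous.exists_eq_sum_of_mem_span {k σ ι : Type*} [CommRing k] [Fintype ι]
    {F : ι → MvPolynomial σ k} {d n : ℕ} (hF : ∀ i, (F i).IsHomogeneous d) (hdn : d ≤ n)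
    {p : MvPolynomial σ k} (hp : p.IsHomogeneous n) (hmem : p ∈ Ideal.span (Set.range F)) :
    ∃ g : ι → MvPolynomial σ k, (∀ i, (g i).IsHomogeneous (n - d)) ∧ p = ∑ i, g i * F i := by
  obtain ⟨c, hc⟩ := (Ideal.mem_span_range_iff_exists_fun).1 hmem
  refine ⟨fun i => homogeneousComponent (n - d) (c i),
    fun i => homogeneousComponent_isHomogeneous _ _, ?_⟩
  have hdec : ∀ (p : MvPolynomial σ k) (m : ℕ),
      (DirectSum.decompose (homogeneousSubmodule σ k) p m : MvPolynomial σ k) =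
        homogeneousComponent m p := decomposition.decompose'_apply
  have key : ∀ i, homogeneousComponent n (c i * F i) =
      homogeneousComponent (n - d) (c i) * F i := fun i => by
    rw [← hdec, ← hdec]
    exact DirectSum.coe_decompose_mul_of_right_mem_of_le (𝒜 := homogeneousSubmodule σ k) (a := c i)
        (b := F i) (i := d) (n := n) (hF i) hdn
  calc p = homogeneousComponent n p := (by simp [homogeneousComponent_of_mem hp])
    _ = _ := by rw [← hc, map_sum]; simp only [key]

/-- Modulo the equations `F i = c i`, where the `F i` are forms of degree `d ≥ 1` whose ideal
contains all monomials of degree at least `M`, every polynomial has total degree at most `M + d`. -/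
theorem span_sub_C_sup_restrictTotalDegree_eq_top {k σ ι : Type*} [CommRing k] [Fintype ι]
    {F : ι → MvPolynomial σ k} {d M : ℕ} (hd : 1 ≤ d) (hF : ∀ i, (F i).IsHomogeneous d)
    (hM : idealOfVars σ k ^ M ≤ Ideal.span (Set.range F)) (c : ι → k) :
    (Ideal.span (Set.range fun i => F i - C (c i))).restrictScalars k ⊔
      restrictTotalDegree σ k (M + d) = ⊤ := by
  set J := Ideal.span (Set.range fun i => F i - C (c i))
  have key : ∀ n, ∀ p : MvPolynomial σ k, p.IsHomogeneous n →
      p ∈ J.restrictScalars k ⊔ restrictTotalDegree σ k (M + d) := by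
    intro n
    induction n using Nat.strong_induction_on with
    | _ n ih =>
      intro p hp
      rcases le_or_gt n (M + d) with hn | hn
      · exact Submodule.mem_sup_right
          ((mem_restrictTotalDegree _ _ _).2 (hp.totalDegree_le.trans hn))
      · have hmem : p ∈ Ideal.span (Set.range F) := by
          refine hM ((mem_pow_idealOfVars_iff _ _).2 fun x hx => ?_)
          have : x.degree = n := by
            have := hp (mem_support_iff.1 hx)
            rwa [Finsupp.degree_eq_weight_one]
          omega
        obtain ⟨g, hg, rfl⟩ := IsHomogeneous.exists_eq_sum_of_mem_span hF (by omega) hp hmem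
        refine Submodule.sum_mem _ fun i _ => ?_
        -- Modulo `J`, trading `F i` for the constant `c i` lowers the degree from `n` to `n - d`, a
        -- strict drop as `d ≥ 1`.
        have : g i * F i = g i * (F i - C (c i)) + c i • g i := by
          rw [smul_eq_C_mul]; ring
        rw [this]
        refine Submodule.add_mem _ (Submodule.mem_sup_left ?_)
          (Submodule.smul_mem _ _ (ih (n - d) (by omega) _ (hg i)))
        exact J.mul_mem_left _ (Ideal.subset_span ⟨i, rfl⟩)
  refine eq_top_iff.2 fun p _ => ?_
  rw [← sum_homogeneousComponent p]
  exact Submodule.sum_mem _ fun i _ => key i _ (homogeneousComponent_isHomogeneous _ _)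

theorem IsHomogeneous.eval_smul {k σ : Type*} [CommRing k] [Fintype σ] {p : MvPolynomial σ k}
    {d : ℕ} (hp : p.IsHomogeneous d) (t : k) (x : σ → k) :
    eval (t • x) p = t ^ d * eval x p := by
  rw [eval_eq', eval_eq', Finset.mul_sum]
  refine Finset.sum_congr rfl fun m hm => ?_
  have hm' : ∑ i, m i = d := by
    have := hp (mem_support_iff.1 hm)
    rwa [← Finsupp.degree_eq_sum, Finsupp.degree_eq_weight_one]
  simp only [Pi.smul_apply, smul_eq_mul, mul_pow, Finset.prod_mul_distrib,
    Finset.prod_pow_eq_pow_sum, hm']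
  ring

/-- The fibres of the affine map given by forms of positive degree without common zeros except the
origin are finite. -/
theorem finite_setOf_eval_eq {k σ ι : Type*} [Field k] [IsAlgClosed k] [Finite σ] [Fintype ι]
    {F : ι → MvPolynomial σ k} {d : ℕ} (hd : 1 ≤ d) (hF : ∀ i, (F i).IsHomogeneous d)
    (h0 : ∀ x : σ → k, x ≠ 0 → (fun i => eval x (F i)) ≠ 0) (c : ι → k) :
    {x : σ → k | (fun i => eval x (F i)) = c}.Finite := by
  -- Nullstellensatz: no common zero lies off the origin.
  have hrad : idealOfVars σ k ≤ (Ideal.span (Set.range F)).radical := by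
    rw [← vanishingIdeal_zeroLocus_eq_radical (K := k)]
    refine Ideal.span_le.2 ?_
    rintro _ ⟨j, rfl⟩ x hx
    have hx0 : x = 0 := by
      by_contra hne
      refine h0 x hne ?_
      funext i
      have := hx (F i) (Ideal.subset_span ⟨i, rfl⟩)
      rwa [aeval_eq_eval] at this
    simp [hx0]
  obtain ⟨M, hM⟩ := Ideal.exists_pow_le_of_le_radical_of_fg hrad (idealOfVars_fg σ k)
  have htop := span_sub_C_sup_restrictTotalDegree_eq_top hd hF hM c
  -- Evaluations at distinct points are independent characters. Those at points of the fibre kill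
  -- the ideal of the `F i - c i`, so they stay independent on the finite-dimensional space of
  -- bounded degree, which bounds their number.
  have hli : LinearIndependent k fun x : {x : σ → k | (fun i => eval x (F i)) = c} =>
      ((aeval x.1 : MvPolynomial σ k →ₐ[k] k).toLinearMap.domRestrict
        (restrictTotalDegree σ k (M + d))) := by
    have hli' : LinearIndependent k fun x : {x : σ → k | (fun i => eval x (F i)) = c} =>
        (aeval x.1 : MvPolynomial σ k →ₐ[k] k).toLinearMap := by
      refine (linearIndependent_algHom_toLinearMap k (MvPolynomial σ k) k).comp
        (fun x : {x : σ → k | (fun i => eval x (F i)) = c} =>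
          (aeval x.1 : MvPolynomial σ k →ₐ[k] k)) fun x y hxy => Subtype.ext ?_
      funext j
      simpa using DFunLike.congr_fun hxy (X j)
    rw [linearIndependent_iff'] at hli' ⊢
    intro s a ha
    refine hli' s a (LinearMap.ext fun p => ?_)
    obtain ⟨q, hq, r, hr, rfl⟩ := Submodule.mem_sup.1 (htop ▸ Submodule.mem_top : p ∈ _)
    have hr0 := DFunLike.congr_fun ha ⟨r, hr⟩
    have hq0 : ∀ x : {x : σ → k | (fun i => eval x (F i)) = c}, eval x.1 q = 0 := fun x => by
      have hle : Ideal.span (Set.range fun i => F i - C (c i)) ≤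
          RingHom.ker (aeval x.1 : MvPolynomial σ k →ₐ[k] k) := by
        refine Ideal.span_le.2 ?_
        rintro _ ⟨i, rfl⟩
        have : eval x.1 (F i) = c i := congrFun x.2 i
        simp [RingHom.mem_ker, aeval_eq_eval, this]
      have := hle hq
      rwa [RingHom.mem_ker, aeval_eq_eval] at this
    simpa [aeval_eq_eval, hq0] using hr0
  exact Set.finite_coe_iff.1 hli.finite

end MvPolynomial

/-- An endomorphism of positive degree has finite fibres. -/
theorem IsGivenBy.finite_preimage_singleton {N d : ℕ} {φ : ProjPt N → ProjPt N}
    {F : Fin (N + 1) → MvPolynomial (Fin (N + 1)) QBar} (h : IsGivenBy φ d F) (hd : 1 ≤ d)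
    (Q : ProjPt N) : (φ ⁻¹' {Q}).Finite := by
  classical
  refine ((MvPolynomial.finite_setOf_eval_eq hd h.homogeneous h.no_common_zero Q.rep).image
    fun x => if hx : x ≠ 0 then Projectivization.mk QBar x hx else Q).subset fun P hP => ?_
  obtain ⟨x, hx, rfl⟩ : ∃ x, ∃ hx : x ≠ 0, Projectivization.mk QBar x hx = P :=
    ⟨P.rep, P.rep_nonzero, P.mk_rep⟩
  have hP' : Projectivization.mk QBar _ (h.no_common_zero x hx) =
      Projectivization.mk QBar Q.rep Q.rep_nonzero := by
    rw [Q.mk_rep, ← h.map_mk x hx]; exact hP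
  obtain ⟨a, ha⟩ := (Projectivization.mk_eq_mk_iff' _ _ _ _ _).1 hP'
  have ha0 : a ≠ 0 := by
    rintro rfl
    exact h.no_common_zero x hx (by rw [← ha, zero_smul])
  -- As `F(x) = a • Q.rep`, scaling `x` by a `d`-th root of `a⁻¹` moves it into the affine fibre
  -- over `Q.rep`.
  obtain ⟨t, ht⟩ := IsAlgClosed.exists_pow_nat_eq a⁻¹ hd
  have ht0 : t ≠ 0 := by
    rintro rfl
    rw [zero_pow (by omega)] at ht
    exact inv_ne_zero ha0 ht.symm
  have htx : t • x ≠ 0 := smul_ne_zero ht0 hx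
  refine ⟨t • x, funext fun i => ?_, ?_⟩
  · have hi := congrFun ha i
    simp only [Pi.smul_apply, smul_eq_mul] at hi
    change MvPolynomial.eval (t • x) (F i) = Q.rep i
    rw [(h.homogeneous i).eval_smul, ht, ← hi, inv_mul_cancel_left₀ ha0]
  · refine (dif_pos htx).trans ?_
    exact (Projectivization.mk_eq_mk_iff' _ _ _ _ _).2 ⟨t, rfl⟩

theorem HeightControlled.finite_preimage_singleton {N : ℕ} {S : Set (ProjEnd N)}
    (hS : HeightControlled S) {φ : ProjEnd N} (hφ : φ ∈ S) (Q : ProjPt N) :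
    (φ.toFun ⁻¹' {Q}).Finite := by
  obtain ⟨d, F, h⟩ := φ.isMorphism
  have h2 : (2 : ℕ∞) ≤ φ.degree := hS.two_le_degree.trans (iInf₂_le φ hφ)
  have hd : φ.degree ≤ d := Nat.sInf_le ⟨F, h⟩
  exact h.finite_preimage_singleton (by have : 2 ≤ φ.degree := by exact_mod_cast h2
                                        omega) Q

/-! ### Shift invariance -/

theorem rightIter_succ_eq {N : ℕ} {S : Set (ProjEnd N)} (γ : ℕ → S) (n : ℕ) :
    rightIter γ (n + 1) = (γ 0).1.toFun ∘ rightIter (fun i => γ (i + 1)) n := by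
  induction n with
  | zero => rfl
  | succ n ih =>
    rw [rightIter, ih]
    rfl

theorem rightOrbit_eq_insert {N : ℕ} {S : Set (ProjEnd N)} (γ : ℕ → S) (P : ProjPt N) :
    rightOrbit γ P = insert P ((γ 0).1.toFun '' rightOrbit (fun i => γ (i + 1)) P) := by
  ext Q
  simp only [rightOrbit, Set.mem_range, Set.mem_insert_iff, Set.mem_image, exists_exists_eq_and]
  rw [← Nat.or_exists_add_one]
  simp only [rightIter_succ_eq, Function.comp_apply]
  exact or_congr_left eq_comm

theorem HeightControlled.finite_rightOrbit_shift_one {N : ℕ} {S : Set (ProjEnd N)}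
    (hS : HeightControlled S) (γ : ℕ → S) (P : ProjPt N) :
    (rightOrbit (fun i => γ (i + 1)) P).Finite ↔ (rightOrbit γ P).Finite := by
  rw [rightOrbit_eq_insert γ P, Set.finite_insert]
  refine ⟨fun h => h.image _, fun h => ?_⟩
  exact (h.preimage' fun Q _ => hS.finite_preimage_singleton (γ 0).2 Q).subset
    (Set.subset_preimage_image _ _)

theorem HeightControlled.finite_rightOrbit_shift {N : ℕ} {S : Set (ProjEnd N)}
    (hS : HeightControlled S) (P : ProjPt N) (n : ℕ) (γ : ℕ → S) :
    (rightOrbit (fun i => γ (i + n)) P).Finite ↔ (rightOrbit γ P).Finite := by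
  induction n with
  | zero => rfl
  | succ n ih =>
    rw [← ih, ← hS.finite_rightOrbit_shift_one (fun i => γ (i + n))]
    simp only [add_assoc, add_comm 1 n]

/-! ### Measurability and the zero-one law -/

instance QBar.countable : Countable QBar := by
  have h := Algebraic.countable ℚ QBar
  rw [Set.eq_univ_of_forall (s := {x : QBar | IsAlgebraic ℚ x})
    fun x => Algebra.IsAlgebraic.isAlgebraic x] at h
  exact Set.countable_univ_iff.1 h

instance ProjPt.countable (N : ℕ) : Countable (ProjPt N) :=
  Quotient.countable

theorem measurableSet_rightIter_eq {N : ℕ} {S : Set (ProjEnd N)} (n : ℕ) (P Q : ProjPt N) :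
    MeasurableSet {γ : ℕ → S | rightIter γ n P = Q} := by
  induction n generalizing P with
  | zero => exact MeasurableSet.const (P = Q)
  | succ n ih =>
    have : {γ : ℕ → S | rightIter γ (n + 1) P = Q} =
        ⋃ R, ((fun γ : ℕ → S => γ n) ⁻¹' {θ | θ.1.toFun P = R}) ∩
          {γ | rightIter γ n R = Q} := by
      ext γ
      simp [rightIter]
    rw [this]
    exact .iUnion fun R => (measurable_pi_apply n (MeasurableSpace.measurableSet_top)).inter (ih R)

theorem measurableSet_finite_rightOrbit {N : ℕ} {S : Set (ProjEnd N)} (P : ProjPt N) :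
    MeasurableSet {γ : ℕ → S | (rightOrbit γ P).Finite} := by
  have : {γ : ℕ → S | (rightOrbit γ P).Finite} =
      -- Countably many points have countably many finite subsets, so this union is countable.
      ⋃ A : Finset (ProjPt N), ⋂ n, ⋃ Q ∈ A, {γ | rightIter γ n P = Q} := by
    ext γ
    simp only [Set.mem_ofPred_eq, Set.mem_iUnion, Set.mem_iInter, exists_prop, exists_eq_right']
    exact ⟨fun h => ⟨h.toFinset, fun n => h.mem_toFinset.2 ⟨n, rfl⟩⟩,
      fun ⟨A, hA⟩ => A.finite_toSet.subset (Set.range_subset_iff.2 hA)⟩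
  rw [this]
  exact .iUnion fun A => .iInter fun n => A.measurableSet_biUnion fun Q _ =>
    measurableSet_rightIter_eq n P Q

/-- A measurable set of sequences which is invariant under all shifts has probability `0` or `1`
for a product measure. -/
theorem infinitePi_eq_zero_or_one_of_shift_invariant {X : Type*} [MeasurableSpace X]
    (μ : Measure X) [IsProbabilityMeasure μ] {E : Set (ℕ → X)} (hE : MeasurableSet E)
    (hshift : ∀ n, (fun γ i => γ (i + n)) ⁻¹' E = E) :
    Measure.infinitePi (fun _ : ℕ => μ) E = 0 ∨ Measure.infinitePi (fun _ : ℕ => μ) E = 1 := by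
  have hind : iIndep (fun i => MeasurableSpace.comap (fun γ : ℕ → X => γ i) inferInstance)
      (Measure.infinitePi fun _ : ℕ => μ) :=
    iIndepFun_infinitePi (P := fun _ : ℕ => μ) (X := fun _ x => x) fun _ => measurable_id
  refine measure_zero_or_one_of_measurableSet_limsup_atTop
    (fun n => (measurable_pi_apply n).comap_le) hind ?_
  rw [limsup_eq_iInf_iSup_of_nat, MeasurableSpace.measurableSet_iInf]
  intro n
  -- Written as a preimage under the `n`-fold shift, `E` depends only on the coordinates of index at
  -- least `n`.
  rw [← hshift n]
  refine @measurable_pi_lambda _ _ _ (_) _ _ (fun i => ?_) _ hE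
  refine Measurable.mono (comap_measurable fun γ : ℕ → X => γ (i + n)) ?_ le_rfl
  exact le_iSup₂_of_le (i + n) (by omega) le_rfl

theorem mainTheorem5 {N : ℕ} (K : IntermediateField ℚ QBar) [FiniteDimensional ℚ K]
    (S : Set (ProjEnd N)) (hS : HeightControlled S) (hK : ∀ φ ∈ S, φ.DefinedOver K)
    (ν : PMF S) (P : ProjPt N) :
    MeasurableSet {γ : ℕ → S | (rightOrbit γ P).Finite} ∧
      (seqMeasure ν {γ : ℕ → S | (rightOrbit γ P).Finite} = 0 ∨
        seqMeasure ν {γ : ℕ → S | (rightOrbit γ P).Finite} = 1) :=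
  ⟨measurableSet_finite_rightOrbit P,
    infinitePi_eq_zero_or_one_of_shift_invariant _ (measurableSet_finite_rightOrbit P) fun n =>
      Set.ext fun γ => hS.finite_rightOrbit_shift P n γ⟩
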